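/- Let $M_0$ be the boundary of $[0,1]^2$. A \emph{square set} is a set $X$ with an injective map $S_X\colon M_0\to X$. A \emph{square metric space} is a square set $X$ with a metric $d_X\le 2$ such that $d_X(S_X(p),S_X(q))=|p-q|$ whenever $p,q$ lie on a common side of the square, and $d_X(S_X(r,s),S_X(t,u))\ge |r-t|+|s-u|$ for all $(r,s),(t,u)\in M_0$. Maps of square sets are functions $f\colon X\to Y$ with $f\circ S_X=S_Y$; the category $\mathsf{SquaMS}$ has square metric spaces as objects and as morphisms the maps of square sets that are short, i.e. $d_Y(f(x),f(y))\le d_X(x,y)$. Let $N=\{0,1,2\}^2$. For a square metric space $X$, let $N\otimes X$ be the quotient of $N\times X$ by the equivalence relation generated by $((i,j),S_X(1,r))\sim((i+1,j),S_X(0,r))$ for $i\in\{0,1\}$, $j\in\{0,1,2\}$, and $((i,j),S_X(r,1))\sim((i,j+1),S_X(r,0))$ for $i\in\{0,1,2\}$, $j\in\{0,1\}$, where $r\in[0,1]$; write $n\otimes x$ for the class of $(n,x)$. The distance on $N\otimes X$ is the infimum of the scores of finite paths in $N\times X$, where a step between $\sim$-equivalent points scores $0$, any other step from $(m,x)$ to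 $(n,y)$ scores $\frac13 d_X(x,y)$ if $m=n$ and $2$ if $m\ne n$. The boundary map of $N\otimes X$ sends $p\in M_0$ to $(i,j)\otimes S_X(3p-(i,j))$ for any $(i,j)\in N$ with $3p-(i,j)\in[0,1]^2$. With $(N\otimes f)(n\otimes x)=n\otimes f(x)$ this is a functor $N\otimes-\colon\mathsf{SquaMS}\to\mathsf{SquaMS}$. Let $U_0=[0,1]^2$ with the taxicab metric and the inclusion $S_{U_0}\colon M_0\to U_0$, and let $\alpha_N\colon N\otimes U_0\to U_0$, $\alpha_N((i,j)\otimes z)=(\tfrac i3,\tfrac j3)+\tfrac13 z$. \textbf{Theorem.} (1) $(U_0,\alpha_N)$ is a corecursive algebra for $N\otimes-$ on $\mathsf{SquaMS}$: for every coalgebra $\beta\colon B\to N\otimes B$ in $\mathsf{SquaMS}$ there is a unique morphism $\beta^\dagger\colon B\to U_0$ of $\mathsf{SquaMS}$ with $\beta^\dagger=\alpha_N\circ(N\otimes\beta^\dagger)\circ\beta$. (2) $\alpha_N$ is an isomorphism in $\mathsf{SquaMS}$, and $(U_0,\alpha_N^{-1})$ is a final coalgebra for $N\otimes-$ on $\mathsf{SquaMS}$.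 (3) For every coalgebra $\beta\colon B\to N\otimes B$ in $\mathsf{SquaMS}$ there is a unique map of square sets $f\colon B\to U_0$, not required to be short, with $f=\alpha_N\circ(N\otimes f)\circ\beta$, and this map is short. -/

import Mathlib

open CategoryTheory

universe u

noncomputable section

/-- The boundary `M₀` of the unit square `[0,1]²`. -/
def SquareBoundary : Type :=
  {p : unitInterval × unitInterval // p.1 = 0 ∨ p.1 = 1 ∨ p.2 = 0 ∨ p.2 = 1}

namespace SquareBoundary

/-- The first coordinate of a boundary point, as a real number. -/
def fst (p : SquareBoundary) : ℝ := p.1.1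

/-- The second coordinate of a boundary point, as a real number. -/
def snd (p : SquareBoundary) : ℝ := p.1.2

/-- The point `(0, r)`. -/
def left (r : unitInterval) : SquareBoundary := ⟨(0, r), Or.inl rfl⟩

/-- The point `(1, r)`. -/
def right (r : unitInterval) : SquareBoundary := ⟨(1, r), Or.inr (Or.inl rfl)⟩

/-- The point `(r, 0)`. -/
def bottom (r : unitInterval) : SquareBoundary := ⟨(r, 0), Or.inr (Or.inr (Or.inl rfl))⟩

/-- The point `(r, 1)`. -/
def top (r : unitInterval) : SquareBoundary := ⟨(r, 1), Or.inr (Or.inr (Or.inr rfl))⟩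

theorem fst_mem (p : SquareBoundary) : 0 ≤ p.fst ∧ p.fst ≤ 1 := p.1.1.2

theorem snd_mem (p : SquareBoundary) : 0 ≤ p.snd ∧ p.snd ≤ 1 := p.1.2.2

theorem ext' {p q : SquareBoundary} (h₁ : p.fst = q.fst) (h₂ : p.snd = q.snd) : p = q :=
  Subtype.ext (Prod.ext (Subtype.ext h₁) (Subtype.ext h₂))

theorem cases' (p : SquareBoundary) :
    p.fst = 0 ∨ p.fst = 1 ∨ p.snd = 0 ∨ p.snd = 1 := by
  rcases p.2 with h | h | h | h
  · left; simp [fst, h]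
  · right; left; simp [fst, h]
  · right; right; left; simp [snd, h]
  · right; right; right; simp [snd, h]

/-- The boundary point with given real coordinates. -/
def mk' (a b : ℝ) (ha : 0 ≤ a ∧ a ≤ 1) (hb : 0 ≤ b ∧ b ≤ 1)
    (h : a = 0 ∨ a = 1 ∨ b = 0 ∨ b = 1) : SquareBoundary :=
  ⟨(⟨a, ha⟩, ⟨b, hb⟩), by
    rcases h with h | h | h | h
    · left; exact Subtype.ext h
    · right; left; exact Subtype.ext h
    · right; right; left; exact Subtype.ext h
    · right; right; right; exact Subtype.ext h⟩

end SquareBoundary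

/-- A square metric space: a metric space bounded by `2`, with an injective map from the boundary
of the unit square which restricts to an isometry on each of the four sides, and is such that
distances of boundary points are bounded below by the taxicab distance. -/
structure SquaMS : Type (u + 1) where
  carrier : Type u
  [metric : MetricSpace carrier]
  S : SquareBoundary → carrier
  S_injective : Function.Injective S
  bounded : ∀ x y : carrier, dist x y ≤ 2
  sq₁_left : ∀ r s : unitInterval,
    dist (S (SquareBoundary.left r)) (S (SquareBoundary.left s)) = |(s : ℝ) - r|
  sq₁_right : ∀ r s : unitInterval,
    dist (S (SquareBoundary.right r)) (S (SquareBoundary.right s)) = |(s : ℝ) - r|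
  sq₁_bottom : ∀ r s : unitInterval,
    dist (S (SquareBoundary.bottom r)) (S (SquareBoundary.bottom s)) = |(s : ℝ) - r|
  sq₁_top : ∀ r s : unitInterval,
    dist (S (SquareBoundary.top r)) (S (SquareBoundary.top s)) = |(s : ℝ) - r|
  sq₂ : ∀ p q : SquareBoundary, |p.fst - q.fst| + |p.snd - q.snd| ≤ dist (S p) (S q)

namespace SquaMS

instance : CoeSort SquaMS.{u} (Type u) := ⟨SquaMS.carrier⟩

instance (X : SquaMS.{u}) : MetricSpace X := X.metric

/-- A morphism of the underlying square sets: a function preserving the boundary maps. -/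
@[ext]
structure SetHom (X Y : SquaMS.{u}) where
  toFun : X → Y
  map_S : ∀ p, toFun (X.S p) = Y.S p

/-- A morphism of square metric spaces: a short map preserving the boundary maps. -/
@[ext]
structure Hom (X Y : SquaMS.{u}) extends SetHom X Y where
  short : ∀ x y, dist (toFun x) (toFun y) ≤ dist x y

instance : Category SquaMS.{u} where
  Hom := Hom
  id X := ⟨⟨id, fun _ => rfl⟩, fun _ _ => le_rfl⟩
  comp f g := ⟨⟨g.toFun ∘ f.toFun, fun p => by simp [f.map_S, g.map_S]⟩,
    fun x y => (g.short _ _).trans (f.short x y)⟩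

end SquaMS

/-! ### The nine-copy functor -/

/-- The index set `N = {0,1,2}²`; the index `(i, j)` is the cell in column `i` and row `j`. -/
abbrev NIndex : Type := Fin 3 × Fin 3

/-- The generating identifications on `N × M₀`: the right side of a cell is identified with the
left side of the cell to its right, the top side with the bottom side of the cell above. -/
inductive NIndex.Adj : NIndex × SquareBoundary → NIndex × SquareBoundary → Prop
  | horizontal (i : Fin 2) (j : Fin 3) (r : unitInterval) :
      NIndex.Adj ((i.castSucc, j), SquareBoundary.right r) ((i.succ, j), SquareBoundary.left r)
  | vertical (i : Fin 3) (j : Fin 2) (r : unitInterval) :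
      NIndex.Adj ((i, j.castSucc), SquareBoundary.top r) ((i, j.succ), SquareBoundary.bottom r)

namespace SquaMS

/-- The identifications of `N × M₀`, transported to `N × X` along the boundary map of `X`. -/
def Glue (X : SquaMS.{u}) (a b : NIndex × X) : Prop :=
  ∃ p q : SquareBoundary, NIndex.Adj (a.1, p) (b.1, q) ∧ a.2 = X.S p ∧ b.2 = X.S q

/-- The equivalence relation `∼` on `N × X` generated by the identifications. -/
def glueSetoid (X : SquaMS.{u}) : Setoid (NIndex × X) := Relation.EqvGen.setoid X.Glue

/-- The underlying set of `N ⊗ X`. -/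
def Tensor (X : SquaMS.{u}) : Type u := Quotient X.glueSetoid

/-- The class `n ⊗ x`. -/
def tmul {X : SquaMS.{u}} (n : NIndex) (x : X) : Tensor X := Quotient.mk X.glueSetoid (n, x)

open scoped Classical in
/-- The metric on `N × X`: scaled by `1/3` in each copy of `X`, and `2` between distinct copies. -/
def copyDist (X : SquaMS.{u}) (a b : NIndex × X) : ℝ :=
  if a.1 = b.1 then dist a.2 b.2 / 3 else 2

open scoped Classical in
/-- The contribution of a pair of consecutive entries to the score of a path in `N × X`. -/
def stepScore (X : SquaMS.{u}) (a b : NIndex × X) : ℝ :=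
  if X.glueSetoid a b then 0 else X.copyDist a b

/-- `X.PathScore a b s` says that `s` is the score of some finite path from `a` to `b`
in `N × X`. -/
inductive PathScore (X : SquaMS.{u}) : NIndex × X → NIndex × X → ℝ → Prop
  | nil (a : NIndex × X) : PathScore X a a 0
  | cons (a b c : NIndex × X) (s : ℝ) (h : PathScore X b c s) :
      PathScore X a c (X.stepScore a b + s)

/-- The quotient distance on `N ⊗ X`: the infimum of the scores of finite paths. -/
def tensorDist (X : SquaMS.{u}) (u v : Tensor X) : ℝ :=
  sInf {s | ∃ a b : NIndex × X, tmul a.1 a.2 = u ∧ tmul b.1 b.2 = v ∧ X.PathScore a b s}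

end SquaMS

namespace SquareBoundary

/-- For `t ∈ [0,1]`, an `i ∈ {0,1,2}` with `i/3 ≤ t ≤ (i+1)/3`. -/
def digit (t : ℝ) : Fin 3 := if t ≤ 1 / 3 then 0 else if t ≤ 2 / 3 then 1 else 2

theorem digit_spec {t : ℝ} (ht : 0 ≤ t ∧ t ≤ 1) :
    0 ≤ 3 * t - ((digit t : ℕ) : ℝ) ∧ 3 * t - ((digit t : ℕ) : ℝ) ≤ 1 := by
  unfold digit
  obtain ⟨h0, h1⟩ := ht
  split_ifs with h h' <;> norm_num <;> constructor <;> linarith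

/-- The index of a cell whose boundary contains the boundary point `p` of the `3 × 3` grid. -/
def cell (p : SquareBoundary) : NIndex := (digit p.fst, digit p.snd)

/-- The position of `p` in the cell `p.cell`, after rescaling by `3`. -/
def local' (p : SquareBoundary) : SquareBoundary :=
  mk' (3 * p.fst - ((digit p.fst : ℕ) : ℝ)) (3 * p.snd - ((digit p.snd : ℕ) : ℝ))
    (digit_spec p.fst_mem) (digit_spec p.snd_mem) (by
      rcases p.cases' with h | h | h | h
      · left; simp [h, digit]
      · right; left; rw [h]; norm_num [digit]
      · right; right; left; simp [h, digit]
      · right; right; right; rw [h]; norm_num [digit])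

end SquareBoundary

namespace NIndex

open SquareBoundary

/-- The coordinates of a boundary point of a cell in the `3 × 3` grid (of side `3`). -/
def pos (a : NIndex × SquareBoundary) : ℝ × ℝ :=
  (((a.1.1 : ℕ) : ℝ) + a.2.fst, ((a.1.2 : ℕ) : ℝ) + a.2.snd)

theorem Adj.pos_eq {a b : NIndex × SquareBoundary} (h : Adj a b) : pos a = pos b := by
  cases h <;> simp [pos, SquareBoundary.left, SquareBoundary.right, SquareBoundary.top,
    SquareBoundary.bottom, SquareBoundary.fst, SquareBoundary.snd]

theorem coord_cases (i k : Fin 3) {a b : ℝ} (ha : 0 ≤ a ∧ a ≤ 1) (hb : 0 ≤ b ∧ b ≤ 1)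
    (h : ((i : ℕ) : ℝ) + a = ((k : ℕ) : ℝ) + b) :
    (i = k ∧ a = b) ∨ (∃ l : Fin 2, i = l.castSucc ∧ k = l.succ ∧ a = 1 ∧ b = 0) ∨
      (∃ l : Fin 2, k = l.castSucc ∧ i = l.succ ∧ b = 1 ∧ a = 0) := by
  obtain ⟨ha0, ha1⟩ := ha
  obtain ⟨hb0, hb1⟩ := hb
  fin_cases i <;> fin_cases k <;> norm_num at h
  · left; exact ⟨rfl, h⟩
  · right; left; exact ⟨0, rfl, rfl, by linarith, by linarith⟩
  · exfalso; linarith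
  · right; right; exact ⟨0, rfl, rfl, by linarith, by linarith⟩
  · left; exact ⟨rfl, h⟩
  · right; left; exact ⟨1, rfl, rfl, by linarith, by linarith⟩
  · exfalso; linarith
  · right; right; exact ⟨1, rfl, rfl, by linarith, by linarith⟩
  · left; exact ⟨rfl, h⟩

theorem horizontal_step (i k j : Fin 3) (p q : SquareBoundary) (hs : p.snd = q.snd)
    (h : ((i : ℕ) : ℝ) + p.fst = ((k : ℕ) : ℝ) + q.fst) :
    Relation.EqvGen Adj ((i, j), p) ((k, j), q) := by
  have hp : ∀ p : SquareBoundary, p.fst = 1 → p = SquareBoundary.right p.1.2 :=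
    fun p hp => ext' hp rfl
  have hq : ∀ p : SquareBoundary, p.fst = 0 → p = SquareBoundary.left p.1.2 :=
    fun p hp => ext' hp rfl
  have hs' : p.1.2 = q.1.2 := Subtype.ext hs
  rcases coord_cases i k p.fst_mem q.fst_mem h with ⟨rfl, h'⟩ | ⟨l, rfl, rfl, h1, h0⟩ |
      ⟨l, rfl, rfl, h1, h0⟩
  · rw [ext' h' hs]; exact Relation.EqvGen.refl _
  · rw [hp p h1, hq q h0, hs']; exact Relation.EqvGen.rel _ _ (Adj.horizontal l j _)
  · rw [hp q h1, hq p h0, hs']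
    exact Relation.EqvGen.symm _ _ (Relation.EqvGen.rel _ _ (Adj.horizontal l j _))

theorem vertical_step (i j l : Fin 3) (p q : SquareBoundary) (hs : p.fst = q.fst)
    (h : ((j : ℕ) : ℝ) + p.snd = ((l : ℕ) : ℝ) + q.snd) :
    Relation.EqvGen Adj ((i, j), p) ((i, l), q) := by
  have hp : ∀ p : SquareBoundary, p.snd = 1 → p = SquareBoundary.top p.1.1 :=
    fun p hp => ext' rfl hp
  have hq : ∀ p : SquareBoundary, p.snd = 0 → p = SquareBoundary.bottom p.1.1 :=
    fun p hp => ext' rfl hp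
  have hs' : p.1.1 = q.1.1 := Subtype.ext hs
  rcases coord_cases j l p.snd_mem q.snd_mem h with ⟨rfl, h'⟩ | ⟨l, rfl, rfl, h1, h0⟩ |
      ⟨l, rfl, rfl, h1, h0⟩
  · rw [ext' hs h']; exact Relation.EqvGen.refl _
  · rw [hp p h1, hq q h0, hs']; exact Relation.EqvGen.rel _ _ (Adj.vertical i l _)
  · rw [hp q h1, hq p h0, hs']
    exact Relation.EqvGen.symm _ _ (Relation.EqvGen.rel _ _ (Adj.vertical i l _))

theorem eqvGen_of_pos_eq {a b : NIndex × SquareBoundary} (h : pos a = pos b) :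
    Relation.EqvGen Adj a b := by
  obtain ⟨⟨i, j⟩, p⟩ := a
  obtain ⟨⟨k, l⟩, q⟩ := b
  obtain ⟨h1, h2⟩ := Prod.ext_iff.1 h
  simp only [pos] at h1 h2
  have hm : q.fst = 0 ∨ q.fst = 1 ∨ p.snd = 0 ∨ p.snd = 1 := by
    rcases coord_cases i k p.fst_mem q.fst_mem h1 with ⟨_, h'⟩ | ⟨_, _, _, _, h'⟩ |
      ⟨_, _, _, h', _⟩
    · rw [← h']; exact p.cases'
    · exact Or.inl h'
    · exact Or.inr (Or.inl h')
  let m := mk' q.fst p.snd q.fst_mem p.snd_mem hm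
  exact Relation.EqvGen.trans _ ((k, j), m) _ (horizontal_step i k j p m rfl h1)
    (vertical_step k j l m q rfl h2)

end NIndex

namespace SquaMS

variable {X Y : SquaMS.{u}}

theorem glue_of_eqvGen {a b : NIndex × SquareBoundary} (h : Relation.EqvGen NIndex.Adj a b) :
    X.glueSetoid (a.1, X.S a.2) (b.1, X.S b.2) := by
  induction h with
  | rel a b h => exact Relation.EqvGen.rel _ _ ⟨a.2, b.2, h, rfl, rfl⟩
  | refl a => exact Relation.EqvGen.refl _
  | symm a b _ ih => exact Relation.EqvGen.symm _ _ ih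
  | trans a b c _ _ ih ih' => exact Relation.EqvGen.trans _ _ _ ih ih'

theorem tmul_eq_of_pos {m n : NIndex} {p q : SquareBoundary}
    (h : NIndex.pos (m, p) = NIndex.pos (n, q)) :
    (tmul m (X.S p) : Tensor X) = tmul n (X.S q) :=
  Quotient.sound (s := X.glueSetoid) (glue_of_eqvGen (NIndex.eqvGen_of_pos_eq h))

theorem tmul_eq_of_glue {a b : NIndex × X} (h : X.glueSetoid a b) :
    (tmul a.1 a.2 : Tensor X) = tmul b.1 b.2 :=
  Quotient.sound (s := X.glueSetoid) h

theorem glue_of_tmul_eq {a b : NIndex × X} (h : (tmul a.1 a.2 : Tensor X) = tmul b.1 b.2) :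
    X.glueSetoid a b :=
  Quotient.exact (s := X.glueSetoid) h

theorem exists_rep (u : Tensor X) : ∃ a : NIndex × X, tmul a.1 a.2 = u :=
  Quotient.exists_rep u

/-- A function on `N × X` which respects the identifications descends to `N ⊗ X`. -/
def tensorLift {T : Type*} (F : NIndex × X → T) (hF : ∀ a b, X.Glue a b → F a = F b) :
    Tensor X → T :=
  Quotient.lift F fun a b (h : Relation.EqvGen X.Glue a b) => by
    induction h with
    | rel a b h => exact hF a b h
    | refl a => rfl
    | symm a b _ ih => exact ih.symm
    | trans a b c _ _ ih ih' => exact ih.trans ih'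

@[simp]
theorem tensorLift_tmul {T : Type*} (F : NIndex × X → T) (hF : ∀ a b, X.Glue a b → F a = F b)
    (n : NIndex) (x : X) : tensorLift F hF (tmul n x) = F (n, x) := rfl

/-- The map `N ⊗ f : n ⊗ x ↦ n ⊗ f x`, for a morphism `f` of square sets. -/
def tensorMap (f : SetHom X Y) : Tensor X → Tensor Y :=
  tensorLift (fun a => tmul a.1 (f.toFun a.2)) (by
    rintro ⟨m, x⟩ ⟨n, y⟩ ⟨p, q, h, hx, hy⟩
    simp only at h hx hy
    subst hx hy
    rw [f.map_S, f.map_S]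
    exact tmul_eq_of_pos h.pos_eq)

@[simp]
theorem tensorMap_tmul (f : SetHom X Y) (n : NIndex) (x : X) :
    tensorMap f (tmul n x) = tmul n (f.toFun x) := rfl

/-! ### The quotient distance is a metric -/

theorem copyDist_nonneg (a b : NIndex × X) : 0 ≤ X.copyDist a b := by
  unfold copyDist; split_ifs <;> positivity

theorem copyDist_le_two (a b : NIndex × X) : X.copyDist a b ≤ 2 := by
  unfold copyDist; split_ifs
  · linarith [X.bounded a.2 b.2]
  · exact le_rfl

theorem copyDist_comm (a b : NIndex × X) : X.copyDist a b = X.copyDist b a := by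
  simp only [copyDist, dist_comm a.2, eq_comm (a := a.1)]

theorem stepScore_nonneg (a b : NIndex × X) : 0 ≤ X.stepScore a b := by
  unfold stepScore; split_ifs
  · exact le_rfl
  · exact copyDist_nonneg a b

theorem stepScore_le (a b : NIndex × X) : X.stepScore a b ≤ X.copyDist a b := by
  unfold stepScore; split_ifs
  · exact copyDist_nonneg a b
  · exact le_rfl

theorem stepScore_comm (a b : NIndex × X) : X.stepScore a b = X.stepScore b a := by
  unfold stepScore
  by_cases h : X.glueSetoid a b
  · rw [if_pos h, if_pos (X.glueSetoid.symm h)]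
  · rw [if_neg h, if_neg fun h' => h (X.glueSetoid.symm h'), copyDist_comm]

theorem stepScore_of_glue {a b : NIndex × X} (h : X.glueSetoid a b) : X.stepScore a b = 0 :=
  if_pos h

theorem PathScore.nonneg {a b : NIndex × X} {s : ℝ} (h : X.PathScore a b s) : 0 ≤ s := by
  induction h with
  | nil a => exact le_rfl
  | cons a b c s _ ih => exact add_nonneg (stepScore_nonneg a b) ih

theorem PathScore.append {a b c : NIndex × X} {s t : ℝ} (h : X.PathScore a b s)
    (h' : X.PathScore b c t) : X.PathScore a c (s + t) := by
  induction h with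
  | nil a => simpa using h'
  | cons a b d s _ ih => rw [add_assoc]; exact PathScore.cons _ _ _ _ (ih h')

theorem PathScore.single (a b : NIndex × X) : X.PathScore a b (X.stepScore a b) := by
  simpa using PathScore.cons a b b 0 (PathScore.nil b)

theorem PathScore.symm {a b : NIndex × X} {s : ℝ} (h : X.PathScore a b s) :
    X.PathScore b a s := by
  induction h with
  | nil a => exact PathScore.nil a
  | cons a b c s _ ih =>
    rw [add_comm, stepScore_comm]; exact ih.append (PathScore.single b a)

theorem tensorDist_le_of_path {a b : NIndex × X} {s : ℝ} (h : X.PathScore a b s) :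
    X.tensorDist (tmul a.1 a.2) (tmul b.1 b.2) ≤ s :=
  csInf_le ⟨0, by rintro _ ⟨_, _, _, _, h⟩; exact h.nonneg⟩ ⟨a, b, rfl, rfl, h⟩

theorem tensorDist_le_copyDist (a b : NIndex × X) :
    X.tensorDist (tmul a.1 a.2) (tmul b.1 b.2) ≤ X.copyDist a b :=
  (tensorDist_le_of_path (PathScore.single a b)).trans (stepScore_le a b)

theorem tensorDist_same (n : NIndex) (x y : X) :
    X.tensorDist (tmul n x) (tmul n y) ≤ dist x y / 3 := by
  simpa [copyDist] using tensorDist_le_copyDist (n, x) (n, y)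

theorem tensorDist_nonempty (u v : Tensor X) :
    {s | ∃ a b : NIndex × X, tmul a.1 a.2 = u ∧ tmul b.1 b.2 = v ∧
      X.PathScore a b s}.Nonempty := by
  obtain ⟨a, ha⟩ := exists_rep u
  obtain ⟨b, hb⟩ := exists_rep v
  exact ⟨_, a, b, ha, hb, PathScore.single a b⟩

theorem tensorDist_nonneg (u v : Tensor X) : 0 ≤ X.tensorDist u v :=
  le_csInf (tensorDist_nonempty u v) (by rintro _ ⟨_, _, _, _, h⟩; exact h.nonneg)

theorem tensorDist_self (u : Tensor X) : X.tensorDist u u = 0 := by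
  obtain ⟨a, rfl⟩ := exists_rep u
  exact le_antisymm (tensorDist_le_of_path (PathScore.nil a)) (tensorDist_nonneg _ _)

theorem tensorDist_comm (u v : Tensor X) : X.tensorDist u v = X.tensorDist v u := by
  unfold tensorDist
  congr 1
  ext s
  constructor <;> rintro ⟨a, b, ha, hb, h⟩ <;> exact ⟨b, a, hb, ha, h.symm⟩

theorem tensorDist_triangle (u v w : Tensor X) :
    X.tensorDist u w ≤ X.tensorDist u v + X.tensorDist v w := by
  refine le_of_forall_pos_le_add fun ε hε => ?_
  obtain ⟨s, ⟨a, b, rfl, rfl, h⟩, hs⟩ :=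
    exists_lt_of_csInf_lt (tensorDist_nonempty u v)
      (show X.tensorDist u v < X.tensorDist u v + ε / 2 by linarith)
  obtain ⟨t, ⟨b', c, hb, rfl, h'⟩, ht⟩ :=
    exists_lt_of_csInf_lt (tensorDist_nonempty (tmul b.1 b.2) w)
      (show X.tensorDist (tmul b.1 b.2) w < X.tensorDist (tmul b.1 b.2) w + ε / 2 by linarith)
  have hbb : X.PathScore b b' 0 := by
    simpa [stepScore_of_glue (glue_of_tmul_eq hb.symm)] using PathScore.single b b'
  have := tensorDist_le_of_path (h.append (hbb.append h'))
  linarith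

/-- A function which is short in each step is short for the quotient distance. -/
theorem dist_le_tensorDist {T : Type*} [PseudoMetricSpace T] (F : Tensor X → T)
    (hF : ∀ a b : NIndex × X, dist (F (tmul a.1 a.2)) (F (tmul b.1 b.2)) ≤ X.copyDist a b)
    (u v : Tensor X) : dist (F u) (F v) ≤ X.tensorDist u v := by
  refine le_csInf (tensorDist_nonempty u v) ?_
  rintro s ⟨a, b, rfl, rfl, h⟩
  induction h with
  | nil a => simp
  | cons a b c s _ ih =>
    refine (dist_triangle _ (F (tmul b.1 b.2)) _).trans (add_le_add ?_ ih)
    unfold stepScore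
    split_ifs with h
    · rw [tmul_eq_of_glue h, dist_self]
    · exact hF a b

/-- Extension of the coordinate function `c₁ r + c₂ s` from the boundary to all of `X`. -/
theorem exists_coord (X : SquaMS.{u}) (c₁ c₂ : ℝ) (h₁ : c₁ = 1 ∨ c₁ = -1)
    (h₂ : c₂ = 1 ∨ c₂ = -1) :
    ∃ g : X → ℝ, (∀ x y, |g x - g y| ≤ dist x y) ∧
      (∀ p, g (X.S p) = c₁ * p.fst + c₂ * p.snd) ∧
      ∀ x, (c₁ - 1) / 2 + (c₂ - 1) / 2 ≤ g x ∧ g x ≤ (c₁ + 1) / 2 + (c₂ + 1) / 2 := by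
  let f : X → ℝ := Function.extend X.S (fun p => c₁ * p.fst + c₂ * p.snd) 0
  have hf : ∀ p, f (X.S p) = c₁ * p.fst + c₂ * p.snd :=
    fun p => X.S_injective.extend_apply _ _ _
  have hL : LipschitzOnWith 1 f (Set.range X.S) := by
    refine LipschitzOnWith.of_dist_le_mul ?_
    rintro _ ⟨p, rfl⟩ _ ⟨q, rfl⟩
    rw [hf, hf, Real.dist_eq]
    refine le_trans ?_ ((X.sq₂ p q).trans (by simp))
    have e1 := le_abs_self (p.fst - q.fst)
    have e2 := neg_abs_le (p.fst - q.fst)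
    have e3 := le_abs_self (p.snd - q.snd)
    have e4 := neg_abs_le (p.snd - q.snd)
    rw [abs_le]
    rcases h₁ with rfl | rfl <;> rcases h₂ with rfl | rfl <;> constructor <;> linarith
  obtain ⟨g, hg, hgf⟩ := hL.extend_real
  set lo := (c₁ - 1) / 2 + (c₂ - 1) / 2 with hlo
  set hi := (c₁ + 1) / 2 + (c₂ + 1) / 2 with hhi
  have hlohi : lo ≤ hi := by rw [hlo, hhi]; linarith
  refine ⟨fun x => max lo (min hi (g x)), fun x y => ?_, fun p => ?_, fun x => ?_⟩
  · have hG : LipschitzWith 1 fun x => max lo (min hi (g x)) := (hg.const_min hi).const_max lo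
    simpa [Real.dist_eq] using hG.dist_le_mul x y
  · have : g (X.S p) = c₁ * p.fst + c₂ * p.snd := by
      rw [← hgf (Set.mem_range_self p), hf]
    simp only [this]
    have e1 := p.fst_mem
    have e2 := p.snd_mem
    rw [min_eq_right, max_eq_right]
    · rw [hlo]; rcases h₁ with rfl | rfl <;> rcases h₂ with rfl | rfl <;> linarith
    · rw [hhi]; rcases h₁ with rfl | rfl <;> rcases h₂ with rfl | rfl <;> linarith
  · exact ⟨le_max_left _ _, max_le hlohi (min_le_left _ _)⟩

theorem coord_le_tensorDist (c₁ c₂ : ℝ) (h₁ : c₁ = 1 ∨ c₁ = -1) (h₂ : c₂ = 1 ∨ c₂ = -1)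
    (m n : NIndex) (p q : SquareBoundary) :
    c₁ * ((NIndex.pos (m, p)).1 - (NIndex.pos (n, q)).1) +
        c₂ * ((NIndex.pos (m, p)).2 - (NIndex.pos (n, q)).2) ≤
      3 * X.tensorDist (tmul m (X.S p)) (tmul n (X.S q)) := by
  obtain ⟨g, hg, hgS, hgb⟩ := exists_coord X c₁ c₂ h₁ h₂
  let F : Tensor X → ℝ := tensorLift
    (fun a => (c₁ * ((a.1.1 : ℕ) : ℝ) + c₂ * ((a.1.2 : ℕ) : ℝ) + g a.2) / 3) (by
      rintro ⟨m, x⟩ ⟨n, y⟩ ⟨p, q, h, hx, hy⟩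
      simp only at h hx hy
      subst hx hy
      obtain ⟨e1, e2⟩ := Prod.ext_iff.1 h.pos_eq
      simp only [NIndex.pos] at e1 e2
      simp only [hgS]
      linear_combination (c₁ * e1 + c₂ * e2) / 3)
  have hF := dist_le_tensorDist F (by
    rintro ⟨⟨i, j⟩, x⟩ ⟨⟨k, l⟩, y⟩
    rw [Real.dist_eq]
    simp only [F, tensorLift_tmul, copyDist]
    split_ifs with h
    · obtain ⟨rfl, rfl⟩ := Prod.ext_iff.1 h
      have := hg x y
      rw [abs_le] at this ⊢
      constructor <;> linarith
    · have hb : ∀ i : Fin 3, (0 : ℝ) ≤ ((i : ℕ) : ℝ) ∧ ((i : ℕ) : ℝ) ≤ 2 := by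
        intro i; fin_cases i <;> norm_num
      have b1 := hb i
      have b2 := hb j
      have b3 := hb k
      have b4 := hb l
      have b5 := hgb x
      have b6 := hgb y
      rw [abs_le]
      rcases h₁ with rfl | rfl <;> rcases h₂ with rfl | rfl <;> constructor <;> linarith)
    (tmul m (X.S p)) (tmul n (X.S q))
  rw [Real.dist_eq] at hF
  have := (le_abs_self _).trans hF
  simp only [F, tensorLift_tmul, hgS] at this
  simp only [NIndex.pos]
  linarith

theorem taxicab_le_tensorDist (m n : NIndex) (p q : SquareBoundary) :
    |(NIndex.pos (m, p)).1 - (NIndex.pos (n, q)).1| +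
        |(NIndex.pos (m, p)).2 - (NIndex.pos (n, q)).2| ≤
      3 * X.tensorDist (tmul m (X.S p)) (tmul n (X.S q)) := by
  have a1 := coord_le_tensorDist (X := X) 1 1 (.inl rfl) (.inl rfl) m n p q
  have a2 := coord_le_tensorDist (X := X) 1 (-1) (.inl rfl) (.inr rfl) m n p q
  have a3 := coord_le_tensorDist (X := X) (-1) 1 (.inr rfl) (.inl rfl) m n p q
  have a4 := coord_le_tensorDist (X := X) (-1) (-1) (.inr rfl) (.inr rfl) m n p q
  rcases abs_cases ((NIndex.pos (m, p)).1 - (NIndex.pos (n, q)).1) with ⟨e, _⟩ | ⟨e, _⟩ <;>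
  rcases abs_cases ((NIndex.pos (m, p)).2 - (NIndex.pos (n, q)).2) with ⟨e', _⟩ | ⟨e', _⟩ <;>
  rw [e, e'] <;> linarith

theorem isClosed_range_S (X : SquaMS.{u}) : IsClosed (Set.range X.S) := by
  have key : ∀ φ : unitInterval → SquareBoundary,
      (∀ r s, dist (X.S (φ r)) (X.S (φ s)) = |(s : ℝ) - r|) →
      IsClosed (Set.range (X.S ∘ φ)) := by
    intro φ h
    have hi : Isometry (X.S ∘ φ) := Isometry.of_dist_eq fun r s => by
      rw [Function.comp, Function.comp, h, Subtype.dist_eq, Real.dist_eq, abs_sub_comm]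
    exact (isCompact_range hi.continuous).isClosed
  have : Set.range X.S = (Set.range (X.S ∘ SquareBoundary.left) ∪
      Set.range (X.S ∘ SquareBoundary.right)) ∪ (Set.range (X.S ∘ SquareBoundary.bottom) ∪
      Set.range (X.S ∘ SquareBoundary.top)) := by
    apply Set.Subset.antisymm
    · rintro _ ⟨p, rfl⟩
      obtain ⟨⟨r, s⟩, h⟩ := p
      rcases h with h | h | h | h <;> simp only at h <;> subst h
      · exact Or.inl (Or.inl ⟨s, rfl⟩)
      · exact Or.inl (Or.inr ⟨s, rfl⟩)
      · exact Or.inr (Or.inl ⟨r, rfl⟩)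
      · exact Or.inr (Or.inr ⟨r, rfl⟩)
    · rintro _ ((⟨r, rfl⟩ | ⟨r, rfl⟩) | (⟨r, rfl⟩ | ⟨r, rfl⟩)) <;> exact ⟨_, rfl⟩
  rw [this]
  exact ((key _ X.sq₁_left).union (key _ X.sq₁_right)).union
    ((key _ X.sq₁_bottom).union (key _ X.sq₁_top))

theorem eq_of_tensorDist_eq_zero_of_notMem {a b : NIndex × X} (ha : a.2 ∉ Set.range X.S)
    (h : X.tensorDist (tmul a.1 a.2) (tmul b.1 b.2) = 0) : a = b := by
  classical
  obtain ⟨m, x⟩ := a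
  obtain ⟨n, y⟩ := b
  obtain ⟨ε, hε, hball⟩ := Metric.isOpen_iff.1 X.isClosed_range_S.isOpen_compl x ha
  have hS : ∀ p, min ε 1 ≤ dist x (X.S p) := by
    intro p
    by_contra hlt
    have : X.S p ∈ Metric.ball x ε := by
      rw [Metric.mem_ball, dist_comm]
      exact (not_le.1 hlt).trans_le (min_le_left _ _)
    exact hball this ⟨p, rfl⟩
  set ρ := min ε 1 with hρ
  have hρ0 : 0 < ρ := lt_min hε one_pos
  have hρ1 : ρ ≤ 1 := min_le_right _ _
  let G : NIndex × X → ℝ := fun c => if c.1 = m then max 0 (ρ - dist x c.2) / 3 else 0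
  have hGS : ∀ c p, c.2 = X.S p → G c = 0 := by
    intro c p hc
    simp only [G]
    split_ifs
    · rw [max_eq_left, zero_div]
      rw [hc]; linarith [hS p]
    · rfl
  have hGb : ∀ c, 0 ≤ G c ∧ G c ≤ 1 := by
    intro c
    simp only [G]
    split_ifs
    · have : max 0 (ρ - dist x c.2) ≤ 1 :=
        max_le zero_le_one (by linarith [dist_nonneg (x := x) (y := c.2)])
      exact ⟨by positivity, by linarith⟩
    · simp
  let F : Tensor X → ℝ := tensorLift G (by
    rintro c d ⟨p, q, _, hc, hd⟩
    rw [hGS c p hc, hGS d q hd])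
  have hF := dist_le_tensorDist F (by
    rintro ⟨k, z⟩ ⟨l, w⟩
    rw [Real.dist_eq]
    change |G (k, z) - G (l, w)| ≤ _
    simp only [copyDist]
    split_ifs with hkl
    · subst hkl
      simp only [G]
      split_ifs
      · rw [← sub_div, abs_div, abs_of_pos (by norm_num : (0 : ℝ) < 3)]
        gcongr
        have h1 := abs_le.1 (abs_dist_sub_le z w x)
        rw [dist_comm z x, dist_comm w x] at h1
        rw [abs_le]
        rcases max_cases 0 (ρ - dist x z) with h2 | h2 <;>
          rcases max_cases 0 (ρ - dist x w) with h3 | h3 <;>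
          constructor <;> linarith [h1.1, h1.2, h2.1, h2.2, h3.1, h3.2]
      · simp only [sub_zero, abs_zero]; positivity
    · have h1 := hGb (k, z)
      have h2 := hGb (l, w)
      rw [abs_le]
      constructor <;> linarith) (tmul m x) (tmul n y)
  rw [h, Real.dist_eq] at hF
  have hGe : G (m, x) = G (n, y) := by
    have := abs_eq_zero.1 (le_antisymm hF (abs_nonneg _))
    change G (m, x) - G (n, y) = 0 at this
    linarith
  have hx : G (m, x) = ρ / 3 := by simp [G, hρ0.le]
  rw [hx] at hGe
  simp only [G] at hGe
  split_ifs at hGe with hn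
  · have h3 : ρ = max 0 (ρ - dist x y) := by linarith
    rcases max_choice 0 (ρ - dist x y) with h4 | h4
    · rw [h4] at h3; linarith
    · rw [h4] at h3
      have : dist x y = 0 := by linarith
      rw [dist_eq_zero.1 this, hn]
  · linarith

theorem eq_of_tensorDist_eq_zero (u v : Tensor X) (h : X.tensorDist u v = 0) : u = v := by
  obtain ⟨a, rfl⟩ := exists_rep u
  obtain ⟨b, rfl⟩ := exists_rep v
  by_cases ha : a.2 ∈ Set.range X.S
  · by_cases hb : b.2 ∈ Set.range X.S
    · obtain ⟨m, x⟩ := a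
      obtain ⟨n, y⟩ := b
      obtain ⟨p, hp⟩ := ha
      obtain ⟨q, hq⟩ := hb
      simp only at hp hq h ⊢
      subst hp hq
      have := taxicab_le_tensorDist (X := X) m n p q
      rw [h] at this
      have h1 := abs_nonneg ((NIndex.pos (m, p)).1 - (NIndex.pos (n, q)).1)
      have h2 := abs_nonneg ((NIndex.pos (m, p)).2 - (NIndex.pos (n, q)).2)
      have h3 := abs_eq_zero.1 (le_antisymm (by linarith) h1)
      have h4 := abs_eq_zero.1 (le_antisymm (by linarith) h2)
      exact tmul_eq_of_pos (Prod.ext (sub_eq_zero.1 h3) (sub_eq_zero.1 h4))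
    · rw [tensorDist_comm] at h
      rw [eq_of_tensorDist_eq_zero_of_notMem hb h]
  · rw [eq_of_tensorDist_eq_zero_of_notMem ha h]

instance (X : SquaMS.{u}) : MetricSpace (Tensor X) where
  dist := X.tensorDist
  dist_self := tensorDist_self
  dist_comm := tensorDist_comm
  dist_triangle := tensorDist_triangle
  eq_of_dist_eq_zero := eq_of_tensorDist_eq_zero _ _

theorem tensor_dist_def (u v : Tensor X) : dist u v = X.tensorDist u v := rfl

/-! ### `N ⊗ X` is a square metric space -/

/-- The boundary map of `N ⊗ X`: each side consists of three copies of the corresponding side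
of `X`. -/
def tensorS (X : SquaMS.{u}) (p : SquareBoundary) : Tensor X := tmul p.cell (X.S p.local')

/-- The boundary map of `N ⊗ X` may be computed in any cell that contains the point. -/
theorem tensorS_eq (p : SquareBoundary) (n : NIndex) (q : SquareBoundary)
    (h₁ : 3 * p.fst = ((n.1 : ℕ) : ℝ) + q.fst) (h₂ : 3 * p.snd = ((n.2 : ℕ) : ℝ) + q.snd) :
    X.tensorS p = tmul n (X.S q) := by
  refine tmul_eq_of_pos (Prod.ext ?_ ?_)
  · rw [NIndex.pos, NIndex.pos, ← h₁]
    exact add_sub_cancel _ _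
  · rw [NIndex.pos, NIndex.pos, ← h₂]
    exact add_sub_cancel _ _

theorem tensor_sq₂ (p q : SquareBoundary) :
    |p.fst - q.fst| + |p.snd - q.snd| ≤ dist (X.tensorS p) (X.tensorS q) := by
  have hpos : ∀ p : SquareBoundary, NIndex.pos (p.cell, p.local') = (3 * p.fst, 3 * p.snd) :=
    fun p => Prod.ext (add_sub_cancel _ _) (add_sub_cancel _ _)
  have := taxicab_le_tensorDist (X := X) p.cell q.cell p.local' q.local'
  rw [hpos, hpos] at this
  simp only [← mul_sub, abs_mul, abs_of_pos (by norm_num : (0 : ℝ) < 3)] at this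
  rw [tensor_dist_def, tensorS, tensorS]
  linarith

theorem short_of_thirds {T : Type*} [PseudoMetricSpace T] (φ : unitInterval → T)
    (h : ∀ (i : Fin 3) (r s r' s' : unitInterval), 3 * (r : ℝ) = ((i : ℕ) : ℝ) + r' →
      3 * (s : ℝ) = ((i : ℕ) : ℝ) + s' → dist (φ r) (φ s) ≤ |(s : ℝ) - r|)
    (r s : unitInterval) : dist (φ r) (φ s) ≤ |(s : ℝ) - r| := by
  have h' : ∀ (i : Fin 3) (r s : unitInterval), ((i : ℕ) : ℝ) ≤ 3 * r →
      (r : ℝ) ≤ s → 3 * (s : ℝ) ≤ ((i : ℕ) : ℝ) + 1 → dist (φ r) (φ s) ≤ s - r := by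
    intro i r s h1 h2 h3
    have := h i r s ⟨3 * r - ((i : ℕ) : ℝ), by constructor <;> linarith⟩
      ⟨3 * s - ((i : ℕ) : ℝ), by constructor <;> linarith⟩ (by simp) (by simp)
    rwa [abs_of_nonneg (by linarith)] at this
  have h0 := h' 0
  have h1 := h' 1
  have h2 := h' 2
  simp only [Fin.val_zero, Fin.val_one, Fin.val_two, Nat.cast_zero, Nat.cast_one,
    Nat.cast_ofNat] at h0 h1 h2
  obtain ⟨a, ha⟩ : ∃ a : unitInterval, (a : ℝ) = 1 / 3 := ⟨⟨1 / 3, by norm_num, by norm_num⟩, rfl⟩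
  obtain ⟨b, hb⟩ : ∃ b : unitInterval, (b : ℝ) = 2 / 3 := ⟨⟨2 / 3, by norm_num, by norm_num⟩, rfl⟩
  have k1 : ∀ r s : unitInterval, (r : ℝ) ≤ s → (s : ℝ) ≤ 2 / 3 → dist (φ r) (φ s) ≤ s - r := by
    intro r s hrs hs
    by_cases c1 : (s : ℝ) ≤ 1 / 3
    · exact h0 r s (by linarith [r.2.1]) hrs (by linarith)
    by_cases c2 : (1 : ℝ) / 3 ≤ r
    · exact h1 r s (by linarith) hrs (by linarith)
    have d1 := h0 r a (by linarith [r.2.1]) (by linarith) (by linarith)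
    have d2 := h1 a s (by linarith) (by linarith) (by linarith)
    linarith [dist_triangle (φ r) (φ a) (φ s)]
  have k2 : ∀ r s : unitInterval, (r : ℝ) ≤ s → dist (φ r) (φ s) ≤ s - r := by
    intro r s hrs
    by_cases c1 : (s : ℝ) ≤ 2 / 3
    · exact k1 r s hrs c1
    by_cases c2 : (2 : ℝ) / 3 ≤ r
    · exact h2 r s (by linarith) hrs (by linarith [s.2.2])
    have d1 := k1 r b (by linarith) (by linarith)
    have d2 := h2 b s (by linarith) (by linarith) (by linarith [s.2.2])
    linarith [dist_triangle (φ r) (φ b) (φ s)]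
  rcases le_total (r : ℝ) s with hrs | hrs
  · exact (k2 r s hrs).trans (le_abs_self _)
  · rw [dist_comm, abs_sub_comm]
    exact (k2 s r hrs).trans (le_abs_self _)

/-- The square metric space `N ⊗ X`. -/
def tensorObj (X : SquaMS.{u}) : SquaMS.{u} where
  carrier := Tensor X
  S := X.tensorS
  S_injective p q h := by
    have := tensor_sq₂ (X := X) p q
    rw [h, dist_self] at this
    have h1 := abs_nonneg (p.fst - q.fst)
    have h2 := abs_nonneg (p.snd - q.snd)
    exact SquareBoundary.ext'
      (sub_eq_zero.1 (abs_eq_zero.1 (le_antisymm (by linarith) h1)))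
      (sub_eq_zero.1 (abs_eq_zero.1 (le_antisymm (by linarith) h2)))
  bounded u v := by
    obtain ⟨a, rfl⟩ := exists_rep u
    obtain ⟨b, rfl⟩ := exists_rep v
    exact (tensorDist_le_copyDist a b).trans (copyDist_le_two a b)
  sq₁_left r s := by
    refine le_antisymm ?_ ?_
    · refine short_of_thirds (fun r => X.tensorS (SquareBoundary.left r)) ?_ r s
      intro i r s r' s' hr hs
      rw [tensorS_eq (.left r) (0, i) (.left r') (by simp [SquareBoundary.left,
        SquareBoundary.fst]) hr, tensorS_eq (.left s) (0, i) (.left s') (by simp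
        [SquareBoundary.left, SquareBoundary.fst]) hs]
      refine (tensorDist_same _ _ _).trans ?_
      rw [X.sq₁_left, show (s' : ℝ) - r' = 3 * (s - r) by linarith, abs_mul,
        abs_of_pos (by norm_num : (0 : ℝ) < 3)]
      linarith
    · refine le_trans ?_ (tensor_sq₂ _ _)
      simp [SquareBoundary.left, SquareBoundary.fst, SquareBoundary.snd, abs_sub_comm]
  sq₁_right r s := by
    refine le_antisymm ?_ ?_
    · refine short_of_thirds (fun r => X.tensorS (SquareBoundary.right r)) ?_ r s
      intro i r s r' s' hr hs
      rw [tensorS_eq (.right r) (2, i) (.right r') (by norm_num [SquareBoundary.right,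
        SquareBoundary.fst]) hr, tensorS_eq (.right s) (2, i) (.right s') (by norm_num
        [SquareBoundary.right, SquareBoundary.fst]) hs]
      refine (tensorDist_same _ _ _).trans ?_
      rw [X.sq₁_right, show (s' : ℝ) - r' = 3 * (s - r) by linarith, abs_mul,
        abs_of_pos (by norm_num : (0 : ℝ) < 3)]
      linarith
    · refine le_trans ?_ (tensor_sq₂ _ _)
      simp [SquareBoundary.right, SquareBoundary.fst, SquareBoundary.snd, abs_sub_comm]
  sq₁_bottom r s := by
    refine le_antisymm ?_ ?_
    · refine short_of_thirds (fun r => X.tensorS (SquareBoundary.bottom r)) ?_ r s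
      intro i r s r' s' hr hs
      rw [tensorS_eq (.bottom r) (i, 0) (.bottom r') hr (by simp [SquareBoundary.bottom,
        SquareBoundary.snd]), tensorS_eq (.bottom s) (i, 0) (.bottom s') hs (by simp
        [SquareBoundary.bottom, SquareBoundary.snd])]
      refine (tensorDist_same _ _ _).trans ?_
      rw [X.sq₁_bottom, show (s' : ℝ) - r' = 3 * (s - r) by linarith, abs_mul,
        abs_of_pos (by norm_num : (0 : ℝ) < 3)]
      linarith
    · refine le_trans ?_ (tensor_sq₂ _ _)
      simp [SquareBoundary.bottom, SquareBoundary.fst, SquareBoundary.snd, abs_sub_comm]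
  sq₁_top r s := by
    refine le_antisymm ?_ ?_
    · refine short_of_thirds (fun r => X.tensorS (SquareBoundary.top r)) ?_ r s
      intro i r s r' s' hr hs
      rw [tensorS_eq (.top r) (i, 2) (.top r') hr (by norm_num [SquareBoundary.top,
        SquareBoundary.snd]), tensorS_eq (.top s) (i, 2) (.top s') hs (by norm_num
        [SquareBoundary.top, SquareBoundary.snd])]
      refine (tensorDist_same _ _ _).trans ?_
      rw [X.sq₁_top, show (s' : ℝ) - r' = 3 * (s - r) by linarith, abs_mul,
        abs_of_pos (by norm_num : (0 : ℝ) < 3)]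
      linarith
    · refine le_trans ?_ (tensor_sq₂ _ _)
      simp [SquareBoundary.top, SquareBoundary.fst, SquareBoundary.snd, abs_sub_comm]
  sq₂ := tensor_sq₂

/-- The morphism `N ⊗ f` of square metric spaces. -/
def tensorHom (f : X ⟶ Y) : tensorObj X ⟶ tensorObj Y where
  toFun := tensorMap f.toSetHom
  map_S p := by
    change (tmul p.cell (f.toFun (X.S p.local')) : Tensor Y) = tmul p.cell (Y.S p.local')
    rw [f.map_S]
  short := dist_le_tensorDist (tensorMap f.toSetHom) fun a b => by
    refine (tensorDist_le_copyDist (a.1, f.toFun a.2) (b.1, f.toFun b.2)).trans ?_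
    unfold copyDist
    dsimp only
    split_ifs
    · linarith [f.short a.2 b.2]
    · exact le_rfl

/-- The functor `N ⊗ -` on square metric spaces. -/
def tensorN : SquaMS.{u} ⥤ SquaMS.{u} where
  obj := tensorObj
  map := tensorHom
  map_id X := by
    refine Hom.ext (funext fun u => ?_)
    obtain ⟨a, rfl⟩ := exists_rep u
    rfl
  map_comp f g := by
    refine Hom.ext (funext fun u => ?_)
    obtain ⟨a, rfl⟩ := exists_rep u
    rfl

end SquaMS

/-! ### The unit square -/

/-- The points of the unit square `[0,1]²`, in any universe. -/
@[ext]
structure UnitSquare : Type u where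
  x : unitInterval
  y : unitInterval

namespace UnitSquare

/-- The taxicab metric. -/
instance : MetricSpace UnitSquare.{u} where
  dist z w := |(z.x : ℝ) - w.x| + |(z.y : ℝ) - w.y|
  dist_self z := by simp
  dist_comm z w := by rw [abs_sub_comm (z.x : ℝ), abs_sub_comm (z.y : ℝ)]
  dist_triangle z w v := by
    have h1 := abs_sub_le (z.x : ℝ) w.x v.x
    have h2 := abs_sub_le (z.y : ℝ) w.y v.y
    linarith
  eq_of_dist_eq_zero {z w} h := by
    have h1 := abs_nonneg ((z.x : ℝ) - w.x)
    have h2 := abs_nonneg ((z.y : ℝ) - w.y)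
    exact UnitSquare.ext
      (Subtype.ext (sub_eq_zero.1 (abs_eq_zero.1 (le_antisymm (by linarith) h1))))
      (Subtype.ext (sub_eq_zero.1 (abs_eq_zero.1 (le_antisymm (by linarith) h2))))

theorem dist_def (z w : UnitSquare.{u}) :
    dist z w = |(z.x : ℝ) - w.x| + |(z.y : ℝ) - w.y| := rfl

theorem third_mem (i : Fin 3) (t : unitInterval) :
    0 ≤ ((i : ℕ) : ℝ) / 3 + 1 / 3 * (t : ℝ) ∧ ((i : ℕ) : ℝ) / 3 + 1 / 3 * (t : ℝ) ≤ 1 := by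
  have h0 := t.2.1
  have h1 := t.2.2
  fin_cases i <;> norm_num <;> constructor <;> linarith

/-- The point `shrink n + z / 3`, where `shrink (i, j) = (i / 3, j / 3)`. -/
def shrinkAdd (n : NIndex) (z : UnitSquare.{u}) : UnitSquare.{u} :=
  ⟨⟨((n.1 : ℕ) : ℝ) / 3 + 1 / 3 * (z.x : ℝ), third_mem n.1 z.x⟩,
    ⟨((n.2 : ℕ) : ℝ) / 3 + 1 / 3 * (z.y : ℝ), third_mem n.2 z.y⟩⟩

end UnitSquare

namespace SquaMS

/-- The unit square `U₀ = [0,1]²` with the taxicab metric and the inclusion of its boundary. -/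
def U₀ : SquaMS.{u} where
  carrier := UnitSquare.{u}
  S p := ⟨p.1.1, p.1.2⟩
  S_injective p q h := by
    obtain ⟨h1, h2⟩ := UnitSquare.mk.inj h
    exact Subtype.ext (Prod.ext h1 h2)
  bounded z w := by
    have h1 := z.x.2
    have h2 := z.y.2
    have h3 := w.x.2
    have h4 := w.y.2
    have h5 : |(z.x : ℝ) - w.x| ≤ 1 := abs_le.2 ⟨by linarith [h1.1, h3.2], by linarith [h1.2, h3.1]⟩
    have h6 : |(z.y : ℝ) - w.y| ≤ 1 := abs_le.2 ⟨by linarith [h2.1, h4.2], by linarith [h2.2, h4.1]⟩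
    rw [UnitSquare.dist_def]
    linarith
  sq₁_left r s := by simp [UnitSquare.dist_def, SquareBoundary.left, abs_sub_comm]
  sq₁_right r s := by simp [UnitSquare.dist_def, SquareBoundary.right, abs_sub_comm]
  sq₁_bottom r s := by simp [UnitSquare.dist_def, SquareBoundary.bottom, abs_sub_comm]
  sq₁_top r s := by simp [UnitSquare.dist_def, SquareBoundary.top, abs_sub_comm]
  sq₂ p q := le_rfl

/-- The function `n ⊗ z ↦ shrink n + z / 3` on `N ⊗ U₀`. -/
def alphaFun : Tensor U₀.{u} → UnitSquare.{u} :=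
  tensorLift (X := U₀.{u}) (fun a => UnitSquare.shrinkAdd a.1 a.2) (by
    rintro ⟨m, x⟩ ⟨n, y⟩ ⟨p, q, h, hx, hy⟩
    simp only at h hx hy
    subst hx hy
    obtain ⟨e1, e2⟩ := Prod.ext_iff.1 h.pos_eq
    simp only [NIndex.pos, SquareBoundary.fst, SquareBoundary.snd] at e1 e2
    refine UnitSquare.ext (Subtype.ext ?_) (Subtype.ext ?_)
    · change ((m.1 : ℕ) : ℝ) / 3 + 1 / 3 * (p.1.1 : ℝ) = ((n.1 : ℕ) : ℝ) / 3 + 1 / 3 * (q.1.1 : ℝ)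
      linarith
    · change ((m.2 : ℕ) : ℝ) / 3 + 1 / 3 * (p.1.2 : ℝ) = ((n.2 : ℕ) : ℝ) / 3 + 1 / 3 * (q.1.2 : ℝ)
      linarith)

/-- The algebra structure `α_N : N ⊗ U₀ ⟶ U₀`, `n ⊗ z ↦ shrink n + z / 3`. -/
def alphaN : tensorN.obj U₀.{u} ⟶ U₀.{u} where
  toFun := alphaFun
  map_S p := by
    refine UnitSquare.ext (Subtype.ext ?_) (Subtype.ext ?_)
    · change ((SquareBoundary.digit p.fst : ℕ) : ℝ) / 3 +
        1 / 3 * (3 * p.fst - ((SquareBoundary.digit p.fst : ℕ) : ℝ)) = p.fst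
      ring
    · change ((SquareBoundary.digit p.snd : ℕ) : ℝ) / 3 +
        1 / 3 * (3 * p.snd - ((SquareBoundary.digit p.snd : ℕ) : ℝ)) = p.snd
      ring
  short := dist_le_tensorDist (X := U₀.{u}) alphaFun fun a b => by
    unfold copyDist
    split_ifs with h
    · obtain ⟨m, z⟩ := a
      obtain ⟨n, w⟩ := b
      simp only at h
      subst h
      refine le_of_eq ?_
      change |((m.1 : ℕ) : ℝ) / 3 + 1 / 3 * (z.x : ℝ) - (((m.1 : ℕ) : ℝ) / 3 + 1 / 3 * (w.x : ℝ))| +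
        |((m.2 : ℕ) : ℝ) / 3 + 1 / 3 * (z.y : ℝ) - (((m.2 : ℕ) : ℝ) / 3 + 1 / 3 * (w.y : ℝ))| =
        (|(z.x : ℝ) - w.x| + |(z.y : ℝ) - w.y|) / 3
      rw [add_sub_add_left_eq_sub, add_sub_add_left_eq_sub, ← mul_sub, ← mul_sub, abs_mul, abs_mul,
        abs_of_pos (by norm_num : (0 : ℝ) < 1 / 3)]
      ring
    · exact U₀.bounded _ _

end SquaMS

/-- An algebra `(A, a)` of an endofunctor `F` is corecursive if for every coalgebra `(E, e)` there
is a unique morphism `f : E ⟶ A` with `f = a ∘ F f ∘ e`. -/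
def IsCorecursiveAlgebra {C : Type*} [Category C] {F : C ⥤ C} (A : Endofunctor.Algebra F) : Prop :=
  ∀ E : Endofunctor.Coalgebra F, ∃! f : E.V ⟶ A.a, f = E.str ≫ F.map f ≫ A.str

end

/-! ### Metric properties of the unit square: contraction by cells and completeness -/

namespace UnitSquare

/-! The corecursive equation says that `f b = shrinkAdd m (f x)` whenever `β b = m ⊗ x`. Since
`shrinkAdd m` divides distances by 3, the operator `f ↦ α_N ∘ (N ⊗ f) ∘ β` is a contraction for the
sup distance, which is at most 2. This gives uniqueness among all maps of square sets
(`IsSolution.unique`), because the estimate never uses shortness of `f`.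

For existence (`exists_short_solution`) the operator is iterated from a short map. The iterates stay
short and keep the boundary fixed, they converge pointwise because the square is complete, and both
properties survive pointwise limits. So the solution is short, and by uniqueness every solution is.

The starting map comes from `exists_hom_U₀`. The taxicab plane is isometric to the sup-metric plane
through `(r, s) ↦ (r + s, r - s)`, so a short map into it amounts to two short real functions. The
lower bound on boundary distances makes `r + s` and `r - s` short on the boundary, and short real
functions extend.

Finality follows once `α_N` is invertible. Its inverse is short because any two points are joined by
a horizontal and a vertical segment of total length equal to their taxicab distance, and on such a
segment the inverse can be estimated one cell at a time. -/

theorem dist_shrinkAdd (n : NIndex) (z w : UnitSquare.{u}) :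
    dist (shrinkAdd n z) (shrinkAdd n w) = dist z w / 3 := by
  simp only [dist_def, shrinkAdd]
  rw [add_sub_add_left_eq_sub, add_sub_add_left_eq_sub, ← mul_sub, ← mul_sub, abs_mul, abs_mul,
    abs_of_pos (by norm_num : (0 : ℝ) < 1 / 3)]
  ring

theorem continuous_shrinkAdd (n : NIndex) : Continuous (shrinkAdd.{u} n) := by
  refine (LipschitzWith.of_dist_le_mul (K := 1) fun z w => ?_).continuous
  rw [dist_shrinkAdd]
  simp only [NNReal.coe_one, one_mul]
  linarith [dist_nonneg (x := z) (y := w)]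

/-- Both coordinates are short, so a Cauchy sequence converges in each; the taxicab distance to the
resulting point is the sum of the coordinate distances. -/
instance : CompleteSpace UnitSquare.{u} := by
  refine Metric.complete_of_cauchySeq_tendsto fun s hs => ?_
  have hx : LipschitzWith 1 (UnitSquare.x : UnitSquare.{u} → unitInterval) :=
    LipschitzWith.of_dist_le_mul fun z w => by
      rw [dist_def, Subtype.dist_eq, Real.dist_eq]
      simp
  have hy : LipschitzWith 1 (UnitSquare.y : UnitSquare.{u} → unitInterval) :=
    LipschitzWith.of_dist_le_mul fun z w => by
      rw [dist_def, Subtype.dist_eq, Real.dist_eq]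
      simp
  obtain ⟨a, ha⟩ := cauchySeq_tendsto_of_complete (hx.uniformContinuous.comp_cauchySeq hs)
  obtain ⟨b, hb⟩ := cauchySeq_tendsto_of_complete (hy.uniformContinuous.comp_cauchySeq hs)
  refine ⟨⟨a, b⟩, tendsto_iff_dist_tendsto_zero.2 ?_⟩
  simpa [dist_def, Subtype.dist_eq, Real.dist_eq] using
    (tendsto_iff_dist_tendsto_zero.1 ha).add (tendsto_iff_dist_tendsto_zero.1 hb)

end UnitSquare

/-! ### Short maps into the taxicab square -/

namespace SquaMS

/-- The taxicab square is injective relative to the boundary: every square metric space admits a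
short map of square sets to it. -/
theorem exists_hom_U₀ (X : SquaMS.{u}) : Nonempty (Hom X U₀.{u}) := by
  -- `g` extends `r + s` and `k` extends `r - s`; half their sum and half their difference restore
  -- `r` and `s`.
  obtain ⟨g, hg, hgS, -⟩ := exists_coord X 1 1 (.inl rfl) (.inl rfl)
  obtain ⟨k, hk, hkS, -⟩ := exists_coord X 1 (-1) (.inl rfl) (.inr rfl)
  -- Away from the boundary `(g ± k) / 2` may leave `[0,1]`; clamping is short and fixes `[0,1]`.
  let P : ℝ → unitInterval := Set.projIcc 0 1 zero_le_one
  have hP : ∀ a b, |(P a : ℝ) - P b| ≤ |a - b| := fun a b => by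
    simpa [Subtype.dist_eq, Real.dist_eq] using
      (LipschitzWith.projIcc (zero_le_one (α := ℝ))).dist_le_mul a b
  refine ⟨⟨⟨fun x => ⟨P ((g x + k x) / 2), P ((g x - k x) / 2)⟩, fun p => ?_⟩, fun x y => ?_⟩⟩
  · refine UnitSquare.ext ?_ ?_
    · rw [hgS, hkS]
      have : (1 * p.fst + 1 * p.snd + (1 * p.fst + -1 * p.snd)) / 2 = p.1.1 := by
        rw [SquareBoundary.fst]; ring
      rw [this]
      exact Set.projIcc_val zero_le_one p.1.1
    · rw [hgS, hkS]
      have : (1 * p.fst + 1 * p.snd - (1 * p.fst + -1 * p.snd)) / 2 = p.1.2 := by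
        rw [SquareBoundary.snd]; ring
      rw [this]
      exact Set.projIcc_val zero_le_one p.1.2
  · refine (UnitSquare.dist_def _ _).trans_le ((add_le_add (hP _ _) (hP _ _)).trans ?_)
    have h1 := abs_le.1 (hg x y)
    have h2 := abs_le.1 (hk x y)
    -- From `|a| + |b| = max |a + b| |a - b|`: here `a + b` and `a - b` are the increments of `g`
    -- and `k`, each bounded by `dist x y`.
    rcases abs_cases ((g x + k x) / 2 - (g y + k y) / 2) with ⟨e, _⟩ | ⟨e, _⟩ <;>
    rcases abs_cases ((g x - k x) / 2 - (g y - k y) / 2) with ⟨e', _⟩ | ⟨e', _⟩ <;>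
    rw [e, e'] <;> linarith [h1.1, h1.2, h2.1, h2.2]

/-! ### The corecursive equation: uniqueness and existence of solutions -/

section Solution

variable {B : SquaMS.{u}}

/-- A map of square sets `f` solves the corecursive equation of a coalgebra structure `β` for the
algebra `(U₀, α_N)`. -/
def IsSolution (β : B ⟶ tensorN.obj B) (f : SetHom B U₀.{u}) : Prop :=
  ∀ b, f.toFun b = alphaN.toFun (tensorMap f (β.toFun b))

/-- Detaches the equation from shortness, so that uniqueness among maps of square sets applies to
morphisms. -/
theorem isSolution_iff {β : B ⟶ tensorN.obj B} {f : B ⟶ U₀.{u}} :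
    f = β ≫ tensorN.map f ≫ alphaN ↔ IsSolution β f.toSetHom :=
  ⟨fun h b => congrFun (congrArg (fun g : Hom B U₀.{u} => g.toFun) h) b,
    fun h => Hom.ext (funext h)⟩

theorem alphaN_tensorMap (f : SetHom B U₀.{u}) (n : NIndex) (x : B) :
    alphaN.toFun (tensorMap f (tmul n x)) = UnitSquare.shrinkAdd n (f.toFun x) := rfl

/-- Each use of the equation trades the distance at `b` for a third of the distance at some other
point `x`. Iterating from the diameter bound 2 forces the distance to be 0. -/
theorem IsSolution.unique {β : B ⟶ tensorN.obj B} {f g : SetHom B U₀.{u}}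
    (hf : IsSolution β f) (hg : IsSolution β g) : f = g := by
  have key : ∀ (n : ℕ) (b : B), dist (f.toFun b) (g.toFun b) ≤ 2 * (1 / 3) ^ n := by
    intro n
    induction n with
    | zero => intro b; simpa using U₀.bounded (f.toFun b) (g.toFun b)
    | succ n ih =>
      intro b
      obtain ⟨⟨m, x⟩, h⟩ := exists_rep (β.toFun b)
      rw [hf b, hg b, ← h, alphaN_tensorMap, alphaN_tensorMap]
      refine (UnitSquare.dist_shrinkAdd _ _ _).trans_le ?_
      have := ih x
      rw [pow_succ]
      change dist (f.toFun x) (g.toFun x) / 3 ≤ _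
      linarith
  refine SetHom.ext (funext fun b => dist_le_zero.1 ?_)
  have := (tendsto_pow_atTop_nhds_zero_of_lt_one (r := (1 / 3 : ℝ)) (by norm_num)
    (by norm_num)).const_mul 2
  rw [mul_zero] at this
  exact ge_of_tendsto' this fun n => key n b

/-- The approximations `f₀`, `α_N ∘ (N ⊗ f₀) ∘ β`, … of a solution. -/
noncomputable def approx (β : B ⟶ tensorN.obj B) (f₀ : B ⟶ U₀.{u}) : ℕ → (B ⟶ U₀.{u})
  | 0 => f₀
  | n + 1 => β ≫ tensorN.map (approx β f₀ n) ≫ alphaN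

/-- The representative `(m, x)` of `β b` does not depend on `n`, so a single choice serves for the
whole sequence of approximations. -/
theorem approx_succ {β : B ⟶ tensorN.obj B} {f₀ : B ⟶ U₀.{u}} {b x : B} {m : NIndex}
    (h : (tmul m x : Tensor B) = β.toFun b) (n : ℕ) :
    (approx β f₀ (n + 1)).toFun b = UnitSquare.shrinkAdd m ((approx β f₀ n).toFun x) := by
  change alphaN.toFun (tensorMap (approx β f₀ n).toSetHom (β.toFun b)) = _
  rw [← h, alphaN_tensorMap]

theorem dist_approx_le (β : B ⟶ tensorN.obj B) (f₀ : B ⟶ U₀.{u}) (n : ℕ) (b : B) :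
    dist ((approx β f₀ n).toFun b) ((approx β f₀ (n + 1)).toFun b) ≤ 2 * (1 / 3) ^ n := by
  -- The induction hypothesis is needed at `x`, where `β b = m ⊗ x`, not at `b`.
  induction n generalizing b with
  | zero => simpa using U₀.bounded ((approx β f₀ 0).toFun b) ((approx β f₀ 1).toFun b)
  | succ n ih =>
    obtain ⟨⟨m, x⟩, h⟩ := exists_rep (β.toFun b)
    rw [approx_succ h, approx_succ h]
    refine (UnitSquare.dist_shrinkAdd _ _ _).trans_le ?_
    have := ih x
    rw [pow_succ]
    change dist ((approx β f₀ n).toFun x) ((approx β f₀ (n + 1)).toFun x) / 3 ≤ _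
    linarith

/-- The pointwise limit of the approximations, which are Cauchy by the geometric bound
`dist_approx_le`. -/
theorem exists_short_solution (β : B ⟶ tensorN.obj B) :
    ∃ f : B ⟶ U₀.{u}, IsSolution β f.toSetHom := by
  obtain ⟨f₀⟩ := exists_hom_U₀ B
  have hlim : ∀ b, ∃ z : UnitSquare.{u}, Filter.Tendsto
      (fun n => ((approx β f₀ n).toFun b : UnitSquare.{u})) Filter.atTop (nhds z) := fun b =>
    cauchySeq_tendsto_of_complete
      (cauchySeq_of_le_geometric (1 / 3) 2 (by norm_num) fun n => dist_approx_le β f₀ n b)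
  choose F hF using hlim
  refine ⟨⟨⟨F, fun p => ?_⟩, fun x y => ?_⟩, fun b => ?_⟩
  -- On the boundary the sequence of approximations is constant.
  · refine tendsto_nhds_unique (hF (B.S p)) ?_
    simp only [(approx β f₀ _).map_S p]
    exact tendsto_const_nhds
  · exact le_of_tendsto' ((hF x).dist (hF y)) fun n => (approx β f₀ n).short x y
  · obtain ⟨⟨m, x⟩, h⟩ := exists_rep (β.toFun b)
    rw [← h, alphaN_tensorMap]
    -- The shifted sequence at `b` is the image under `shrinkAdd m` of the sequence at `x`;
    -- continuity passes the recursion to the limit.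
    refine tendsto_nhds_unique ((Filter.tendsto_add_atTop_iff_nat 1).2 (hF b)) ?_
    simp only [approx_succ h]
    exact ((UnitSquare.continuous_shrinkAdd m).tendsto _).comp (hF x)

theorem existsUnique_hom (β : B ⟶ tensorN.obj B) :
    ∃! f : B ⟶ U₀.{u}, f = β ≫ tensorN.map f ≫ alphaN := by
  obtain ⟨f, hf⟩ := exists_short_solution β
  exact ⟨f, isSolution_iff.2 hf, fun g hg =>
    Hom.ext (congrArg SetHom.toFun ((isSolution_iff.1 hg).unique hf))⟩

end Solution

/-! ### The inverse of `α_N` -/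

theorem tmul_eq_of_right_left (l : Fin 2) (j : Fin 3) {z w : UnitSquare.{u}}
    (hz : (z.x : ℝ) = 1) (hw : (w.x : ℝ) = 0) (h : z.y = w.y) :
    (tmul (l.castSucc, j) z : Tensor U₀.{u}) = tmul (l.succ, j) w := by
  have e1 : z = U₀.{u}.S (SquareBoundary.right z.y) := UnitSquare.ext (Subtype.ext hz) rfl
  have e2 : w = U₀.{u}.S (SquareBoundary.left z.y) := UnitSquare.ext (Subtype.ext hw) h.symm
  rw [e1, e2]
  exact tmul_eq_of_pos (NIndex.Adj.horizontal l j z.y).pos_eq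

theorem tmul_eq_of_top_bottom (i : Fin 3) (l : Fin 2) {z w : UnitSquare.{u}}
    (hz : (z.y : ℝ) = 1) (hw : (w.y : ℝ) = 0) (h : z.x = w.x) :
    (tmul (i, l.castSucc) z : Tensor U₀.{u}) = tmul (i, l.succ) w := by
  have e1 : z = U₀.{u}.S (SquareBoundary.top z.x) := UnitSquare.ext rfl (Subtype.ext hz)
  have e2 : w = U₀.{u}.S (SquareBoundary.bottom z.x) := UnitSquare.ext h.symm (Subtype.ext hw)
  rw [e1, e2]
  exact tmul_eq_of_pos (NIndex.Adj.vertical i l z.x).pos_eq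

/-- This is the injectivity of `α_N`: two cells overlap only along sides and corners, where the
gluing identifies them. -/
theorem tmul_eq_of_coord_eq {m n : NIndex} {z w : UnitSquare.{u}}
    (h₁ : ((m.1 : ℕ) : ℝ) + z.x = ((n.1 : ℕ) : ℝ) + w.x)
    (h₂ : ((m.2 : ℕ) : ℝ) + z.y = ((n.2 : ℕ) : ℝ) + w.y) :
    (tmul m z : Tensor U₀.{u}) = tmul n w := by
  obtain ⟨i, j⟩ := m
  obtain ⟨k, l⟩ := n
  -- Changing the column first and then the row crosses at most one side at a time, which also
  -- covers cells that meet only in a corner.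
  trans (tmul (k, j) (⟨w.x, z.y⟩ : UnitSquare.{u}) : Tensor U₀.{u})
  · rcases NIndex.coord_cases i k z.x.2 w.x.2 h₁ with ⟨rfl, h⟩ | ⟨l, rfl, rfl, h, h'⟩ |
      ⟨l, rfl, rfl, h, h'⟩
    · rw [← Subtype.ext h]
    · exact tmul_eq_of_right_left l j h h' rfl
    · symm
      exact tmul_eq_of_right_left l j h h' rfl
  · rcases NIndex.coord_cases j l z.y.2 w.y.2 h₂ with ⟨rfl, h⟩ | ⟨l, rfl, rfl, h, h'⟩ |
      ⟨l, rfl, rfl, h, h'⟩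
    · rw [Subtype.ext h]
    · exact tmul_eq_of_top_bottom k l h h' rfl
    · symm
      exact tmul_eq_of_top_bottom k l h h' rfl

/-- The inverse of `α_N` as a function. -/
noncomputable def alphaInvFun (z : UnitSquare.{u}) : Tensor U₀.{u} :=
  tmul (SquareBoundary.digit z.x, SquareBoundary.digit z.y)
    (⟨⟨_, SquareBoundary.digit_spec z.x.2⟩, ⟨_, SquareBoundary.digit_spec z.y.2⟩⟩ : UnitSquare.{u})

/-- Any cell containing the point may be used, so the tie-breaking in `digit` on grid lines is
harmless. -/
theorem alphaInvFun_eq {z : UnitSquare.{u}} {n : NIndex} {w : UnitSquare.{u}}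
    (h₁ : 3 * (z.x : ℝ) = ((n.1 : ℕ) : ℝ) + w.x) (h₂ : 3 * (z.y : ℝ) = ((n.2 : ℕ) : ℝ) + w.y) :
    alphaInvFun z = tmul n w :=
  tmul_eq_of_coord_eq (by rw [← h₁]; exact add_sub_cancel _ _)
    (by rw [← h₂]; exact add_sub_cancel _ _)

theorem alphaFun_alphaInvFun (z : UnitSquare.{u}) : alphaFun (alphaInvFun z) = z := by
  refine UnitSquare.ext (Subtype.ext ?_) (Subtype.ext ?_)
  · change ((SquareBoundary.digit z.x : ℕ) : ℝ) / 3 +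
      1 / 3 * (3 * (z.x : ℝ) - ((SquareBoundary.digit z.x : ℕ) : ℝ)) = z.x
    ring
  · change ((SquareBoundary.digit z.y : ℕ) : ℝ) / 3 +
      1 / 3 * (3 * (z.y : ℝ) - ((SquareBoundary.digit z.y : ℕ) : ℝ)) = z.y
    ring

theorem alphaInvFun_alphaFun (u : Tensor U₀.{u}) : alphaInvFun (alphaFun u) = u := by
  obtain ⟨⟨n, z⟩, rfl⟩ := exists_rep u
  change UnitSquare.{u} at z
  refine alphaInvFun_eq ?_ ?_
  · change 3 * (((n.1 : ℕ) : ℝ) / 3 + 1 / 3 * (z.x : ℝ)) = _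
    ring
  · change 3 * (((n.2 : ℕ) : ℝ) / 3 + 1 / 3 * (z.y : ℝ)) = _
    ring

theorem exists_third (t : unitInterval) :
    ∃ (i : Fin 3) (s : unitInterval), 3 * (t : ℝ) = ((i : ℕ) : ℝ) + s :=
  ⟨SquareBoundary.digit t, ⟨_, SquareBoundary.digit_spec t.2⟩, (add_sub_cancel _ _).symm⟩

/-- A segment over one third of the side lies in one cell, where magnifying by 3 cancels the factor
`1/3` of the copy; `short_of_thirds` joins the pieces. -/
theorem dist_alphaInvFun_horizontal (r s t : unitInterval) :
    dist (alphaInvFun ⟨r, t⟩ : Tensor U₀.{u}) (alphaInvFun ⟨s, t⟩) ≤ |(s : ℝ) - r| := by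
  refine short_of_thirds (fun r => (alphaInvFun ⟨r, t⟩ : Tensor U₀.{u})) ?_ r s
  intro i r s r' s' hr hs
  -- One row `j` serves both endpoints, so they lie in the common cell `(i, j)`.
  obtain ⟨j, t', ht⟩ := exists_third t
  rw [alphaInvFun_eq (n := (i, j)) (w := ⟨r', t'⟩) hr ht,
    alphaInvFun_eq (n := (i, j)) (w := ⟨s', t'⟩) hs ht]
  refine (tensorDist_same _ _ _).trans ?_
  change (|(r' : ℝ) - s'| + |(t' : ℝ) - t'|) / 3 ≤ _
  rw [sub_self, abs_zero, add_zero, show (r' : ℝ) - s' = 3 * (r - s) by linarith, abs_mul,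
    abs_of_pos (by norm_num : (0 : ℝ) < 3), abs_sub_comm]
  linarith

theorem dist_alphaInvFun_vertical (t r s : unitInterval) :
    dist (alphaInvFun ⟨t, r⟩ : Tensor U₀.{u}) (alphaInvFun ⟨t, s⟩) ≤ |(s : ℝ) - r| := by
  refine short_of_thirds (fun r => (alphaInvFun ⟨t, r⟩ : Tensor U₀.{u})) ?_ r s
  intro i r s r' s' hr hs
  obtain ⟨j, t', ht⟩ := exists_third t
  rw [alphaInvFun_eq (n := (j, i)) (w := ⟨t', r'⟩) ht hr,
    alphaInvFun_eq (n := (j, i)) (w := ⟨t', s'⟩) ht hs]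
  refine (tensorDist_same _ _ _).trans ?_
  change (|(t' : ℝ) - t'| + |(r' : ℝ) - s'|) / 3 ≤ _
  rw [sub_self, abs_zero, zero_add, show (r' : ℝ) - s' = 3 * (r - s) by linarith, abs_mul,
    abs_of_pos (by norm_num : (0 : ℝ) < 3), abs_sub_comm]
  linarith

/-- The inverse of `α_N`. -/
noncomputable def alphaInv : U₀.{u} ⟶ tensorN.obj U₀.{u} where
  toFun := alphaInvFun
  map_S p := (congrArg alphaInvFun (alphaN.map_S p)).symm.trans (alphaInvFun_alphaFun _)
  short z w := by
    change UnitSquare.{u} at z w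
    have h1 := dist_alphaInvFun_horizontal.{u} z.x w.x z.y
    have h2 := dist_alphaInvFun_vertical.{u} w.x z.y w.y
    -- The detour through the corner `(w.x, z.y)` costs nothing in the taxicab metric.
    refine (dist_triangle (alphaInvFun z) (alphaInvFun ⟨w.x, z.y⟩) (alphaInvFun w)).trans
      ((add_le_add h1 h2).trans_eq ?_)
    change _ = |(z.x : ℝ) - w.x| + |(z.y : ℝ) - w.y|
    rw [abs_sub_comm (z.x : ℝ), abs_sub_comm (z.y : ℝ)]

/-- The isomorphism `N ⊗ U₀ ≅ U₀` given by `α_N`. -/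
noncomputable def alphaIso : tensorN.obj U₀.{u} ≅ U₀.{u} where
  hom := alphaN
  inv := alphaInv
  hom_inv_id := Hom.ext (funext alphaInvFun_alphaFun)
  inv_hom_id := Hom.ext (funext alphaFun_alphaInvFun)

/-! ### Finality of the inverse coalgebra -/

/-- Moving the isomorphism `α_N` across the coalgebra square turns it into the corecursive equation,
so coalgebra morphisms into `U₀` are exactly the short solutions. -/
theorem nonempty_isTerminal_alphaIso_inv :
    Nonempty (Limits.IsTerminal
      (⟨U₀.{u}, alphaIso.inv⟩ : Endofunctor.Coalgebra tensorN.{u})) := by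
  have key : ∀ (B : Endofunctor.Coalgebra tensorN.{u}) (f : B.V ⟶ U₀.{u}),
      B.str ≫ tensorN.map f = f ≫ alphaIso.inv ↔ f = B.str ≫ tensorN.map f ≫ alphaN := by
    intro B f
    rw [Iso.eq_comp_inv, Category.assoc, eq_comm]
    rfl
  refine ⟨Limits.IsTerminal.ofUniqueHom
    (fun B => ⟨(existsUnique_hom B.str).choose,
      (key B _).2 (existsUnique_hom B.str).choose_spec.1⟩) fun B g => ?_⟩
  exact Endofunctor.Coalgebra.Hom.ext
    ((existsUnique_hom B.str).choose_spec.2 g.f ((key B g.f).1 g.h))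

end SquaMS

/-- The unit square with the taxicab metric and `α_N` is a corecursive algebra for `N ⊗ -` on
square metric spaces; `α_N` is invertible and `(U₀, α_N⁻¹)` is a final coalgebra; and for every
coalgebra of square metric spaces there is exactly one solution among all maps of square sets,
and it is short. -/
theorem mainTheorem4 :
    IsCorecursiveAlgebra (⟨SquaMS.U₀.{u}, SquaMS.alphaN⟩ : Endofunctor.Algebra SquaMS.tensorN.{u}) ∧
    (∃ e : SquaMS.tensorN.obj SquaMS.U₀.{u} ≅ SquaMS.U₀.{u}, e.hom = SquaMS.alphaN ∧
      Nonempty (Limits.IsTerminal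
        (⟨SquaMS.U₀.{u}, e.inv⟩ : Endofunctor.Coalgebra SquaMS.tensorN.{u}))) ∧
    (∀ B : Endofunctor.Coalgebra SquaMS.tensorN.{u},
      (∃! f : SquaMS.SetHom B.V SquaMS.U₀.{u},
        ∀ b, f.toFun b = SquaMS.alphaN.toFun (SquaMS.tensorMap f (B.str.toFun b))) ∧
      ∀ f : SquaMS.SetHom B.V SquaMS.U₀.{u},
        (∀ b, f.toFun b = SquaMS.alphaN.toFun (SquaMS.tensorMap f (B.str.toFun b))) →
        ∀ b c, dist (f.toFun b) (f.toFun c) ≤ dist b c) := by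
  refine ⟨fun B => SquaMS.existsUnique_hom B.str,
    ⟨SquaMS.alphaIso, rfl, SquaMS.nonempty_isTerminal_alphaIso_inv⟩, fun B => ?_⟩
  obtain ⟨f, hf⟩ := SquaMS.exists_short_solution B.str
  refine ⟨⟨f.toSetHom, hf, fun g hg => SquaMS.IsSolution.unique hg hf⟩, fun g hg => ?_⟩
  -- An arbitrary solution coincides with the short one, hence is short.
  rw [SquaMS.IsSolution.unique hg hf]
  exact f.short
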